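/- Let $G$ be a second countable locally compact (Hausdorff) group with left Haar measure $\mu_G$, and let $\pi : G \to \mathcal{U}(\mathcal{H})$ be a projective unitary representation on a complex Hilbert space $\mathcal{H}$, i.e. a strongly measurable map with $\pi(e) = I$ and $\pi(g_1)\pi(g_2) = \sigma(g_1,g_2)\pi(g_1g_2)$ for some measurable $\sigma : G \times G \to \mathbb{T}$. For $f, \psi \in \mathcal{H}$ put $C_\psi f(g) = \langle f, \pi(g)\psi\rangle$, and let $\|C_\psi f\|$ denote its norm in $L^2(G, \mu_G)$ (a priori possibly infinite). Fix a compact neighbourhood $Q$ of the identity and let $\mathcal{B}_\pi$ be the set of all $\psi \in \mathcal{H}$ such that for every $f \in \mathcal{H}$ the function $F = C_\psi f$ lies in $L^\infty_{\mathrm{loc}}(G)$ and $g \mapsto \sup_{q \in Q} |F(gq)|$ has finite $L^2(G,\mu_G)$-norm. Let $\Lambda \subseteq G$ be a Delone set, i.e. there are a nonempty open $U \subseteq G$ and a compact $K \subseteq G$ with $\#(\Lambda \cap gU) \leq 1 \leq \#(\Lambda \cap gK)$ for all $g \in G$. Equip the set $\mathcal{C}(G)$ of closed subsets of $G$ with the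 Chabauty--Fell topology, in which the sets $\{C' \in \mathcal{C}(G) : C' \cap L \subseteq CV, \ C \cap L \subseteq C'V\}$, with $L \subseteq G$ compact and $V \subseteq G$ an open neighbourhood of the identity, form a neighbourhood basis at $C$. The hull of $\Lambda$ is $\Omega(\Lambda) := \overline{\{x\Lambda : x \in G\}} \subseteq \mathcal{C}(G)$, on which $G$ acts by left translation. Let $\nu$ be a $G$-invariant Borel probability measure on $\Omega(\Lambda)$, and let $\psi \in \mathcal{H}$. Then the covolume $\mathrm{covol}_\nu(\Lambda)$ is well defined as the unique $c \in (0,\infty)$ such that, for every $f \in C_c(G)$, the function $\Gamma \mapsto \sum_{\gamma \in \Gamma} f(\gamma)$ is $\nu$-integrable and \[ \int_{\Omega(\Lambda)} \sum_{\gamma \in \Gamma} f(\gamma) \, d\nu(\Gamma) = c^{-1} \int_G f \, d\mu_G, \] and the following hold. (i) If $\pi(\Lambda)\psi$ is a Bessel sequence with bound $C_2 > 0$, i.e. $\sum_{\lambda \in \Lambda} |\langle f, \pi(\lambda)\psi\rangle|^2 \leq C_2 \|f\|^2$ for all $f \in \mathcal{H}$, then \[ \|C_\psi f\|^2 \leq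 C_2 \, \mathrm{covol}_\nu(\Lambda) \, \|f\|^2 \quad \text{for all } f \in \mathcal{H}. \] (ii) If $\psi \in \mathcal{B}_\pi$ and $\pi(\Lambda)\psi$ admits a lower frame bound $C_1 > 0$, i.e. $\sum_{\lambda \in \Lambda} |\langle f, \pi(\lambda)\psi\rangle|^2 \geq C_1 \|f\|^2$ for all $f \in \mathcal{H}$, then \[ \|C_\psi f\|^2 \geq C_1 \, \mathrm{covol}_\nu(\Lambda) \, \|f\|^2 \quad \text{for all } f \in \mathcal{H}. \] -/

import Mathlib

open MeasureTheory Topology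
open scoped Pointwise ENNReal

noncomputable section

namespace FrameCovol

/-! ### Delone sets -/

section PointSets

variable {G : Type*} [Group G] [TopologicalSpace G]

/-- `Λ` is `S`-separated: every left translate `g S` contains at most one point of `Λ`. -/
def IsSeparatedBy (S Λ : Set G) : Prop := ∀ g : G, (Λ ∩ g • S).Subsingleton

/-- `Λ` is `S`-dense: every left translate `g S` contains at least one point of `Λ`. -/
def IsDenseBy (S Λ : Set G) : Prop := ∀ g : G, (Λ ∩ g • S).Nonempty

/-- `Λ` is a Delone set: it is `U`-separated for some nonempty open `U` and `K`-dense for some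
compact `K`. -/
def IsDelone (Λ : Set G) : Prop :=
  (∃ U : Set G, IsOpen U ∧ U.Nonempty ∧ IsSeparatedBy U Λ) ∧
    ∃ K : Set G, IsCompact K ∧ IsDenseBy K Λ

theorem IsDelone.isClosed [IsTopologicalGroup G] [T1Space G] {Λ : Set G} (h : IsDelone Λ) :
    IsClosed Λ := by
  obtain ⟨⟨U, hU, ⟨u, hu⟩, hsep⟩, -⟩ := h
  refine isClosed_of_closure_subset fun x hx => ?_
  have hN : IsOpen ((x * u⁻¹) • U) := hU.smul _
  have hxN : x ∈ (x * u⁻¹) • U := ⟨u, hu, by simp⟩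
  obtain ⟨y, hyN, hyΛ⟩ := mem_closure_iff.1 hx _ hN hxN
  by_contra hxΛ
  have hxy : x ≠ y := fun e => hxΛ (e ▸ hyΛ)
  obtain ⟨z, ⟨hzN, hzy⟩, hzΛ⟩ := mem_closure_iff.1 hx (((x * u⁻¹) • U) ∩ {y}ᶜ)
    (hN.inter isOpen_compl_singleton) ⟨hxN, hxy⟩
  exact hzy (hsep _ ⟨hzΛ, hzN⟩ ⟨hyΛ, hyN⟩)

end PointSets

/-! ### The Chabauty–Fell space of closed subsets and the hull -/

/-- The set `𝒞(G)` of all closed subsets of `G` (a copy of `Closeds G`, which will carry the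
Chabauty–Fell topology). -/
def ClosedSubset (G : Type*) [TopologicalSpace G] : Type _ := TopologicalSpace.Closeds G

namespace ClosedSubset

variable {G : Type*} [TopologicalSpace G]

instance : SetLike (ClosedSubset G) G := inferInstanceAs (SetLike (TopologicalSpace.Closeds G) G)

/-- A closed set as a point of `𝒞(G)`. -/
def mk (C : Set G) (hC : IsClosed C) : ClosedSubset G := (⟨C, hC⟩ : TopologicalSpace.Closeds G)

@[simp] theorem coe_mk (C : Set G) (hC : IsClosed C) : (mk C hC : Set G) = C := rfl

theorem isClosed (C : ClosedSubset G) : IsClosed (C : Set G) :=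
  TopologicalSpace.Closeds.isClosed C

variable [Group G]

/-- The basic neighbourhood
`V_{K,U}(C) = {C' : C' ∩ K ⊆ C U and C ∩ K ⊆ C' U}` of `C`. -/
def basicNhd (K U : Set G) (C : ClosedSubset G) : Set (ClosedSubset G) :=
  {C' | (C' : Set G) ∩ K ⊆ (C : Set G) * U ∧ (C : Set G) ∩ K ⊆ (C' : Set G) * U}

theorem basicNhd_mono {K K' U U' : Set G} (hK : K ⊆ K') (hU : U' ⊆ U) (C : ClosedSubset G) :
    basicNhd K' U' C ⊆ basicNhd K U C := fun _ h =>
  ⟨fun _ hx => Set.mul_subset_mul_left hU (h.1 ⟨hx.1, hK hx.2⟩),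
    fun _ hx => Set.mul_subset_mul_left hU (h.2 ⟨hx.1, hK hx.2⟩)⟩

/-- The Chabauty–Fell topology: `O` is open iff with each `C` it contains some `V_{K,U}(C)`, where
`K` is compact and `U` is an open neighbourhood of the identity. -/
instance : TopologicalSpace (ClosedSubset G) where
  IsOpen O := ∀ C ∈ O, ∃ K U : Set G, IsCompact K ∧ IsOpen U ∧ 1 ∈ U ∧ basicNhd K U C ⊆ O
  isOpen_univ _ _ := ⟨∅, Set.univ, isCompact_empty, isOpen_univ, trivial, Set.subset_univ _⟩
  isOpen_inter := by
    rintro s t hs ht C ⟨hCs, hCt⟩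
    obtain ⟨K, U, hK, hU, h1, h⟩ := hs C hCs
    obtain ⟨K', U', hK', hU', h1', h'⟩ := ht C hCt
    exact ⟨K ∪ K', U ∩ U', hK.union hK', hU.inter hU', ⟨h1, h1'⟩, Set.subset_inter
      ((basicNhd_mono Set.subset_union_left Set.inter_subset_left C).trans h)
      ((basicNhd_mono Set.subset_union_right Set.inter_subset_right C).trans h')⟩
  isOpen_sUnion := by
    rintro S hS C ⟨s, hs, hCs⟩
    obtain ⟨K, U, hK, hU, h1, h⟩ := hS s hs C hCs
    exact ⟨K, U, hK, hU, h1, h.trans (Set.subset_sUnion_of_mem hs)⟩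

theorem isOpen_iff {O : Set (ClosedSubset G)} :
    IsOpen O ↔ ∀ C ∈ O, ∃ K U : Set G, IsCompact K ∧ IsOpen U ∧ 1 ∈ U ∧ basicNhd K U C ⊆ O :=
  Iff.rfl

theorem mem_basicNhd_self {K U : Set G} (h1 : (1 : G) ∈ U) (C : ClosedSubset G) :
    C ∈ basicNhd K U C :=
  ⟨fun x hx => ⟨x, hx.1, 1, h1, mul_one x⟩, fun x hx => ⟨x, hx.1, 1, h1, mul_one x⟩⟩

/-- The sets `V_{K,U}(C)` indeed form a neighbourhood basis at `C`. -/
theorem mem_nhds_iff_basicNhd [IsTopologicalGroup G] [LocallyCompactSpace G]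
    {C : ClosedSubset G} {N : Set (ClosedSubset G)} :
    N ∈ 𝓝 C ↔
      ∃ K U : Set G, IsCompact K ∧ IsOpen U ∧ 1 ∈ U ∧ basicNhd K U C ⊆ N := by
  constructor
  · intro hN
    obtain ⟨O, hON, hO, hCO⟩ := mem_nhds_iff.1 hN
    obtain ⟨K, U, hK, hU, h1, h⟩ := hO C hCO
    exact ⟨K, U, hK, hU, h1, h.trans hON⟩
  · rintro ⟨K, U, hK, hU, h1, h⟩
    refine Filter.mem_of_superset (mem_nhds_iff.2 ⟨{D | ∃ K' U' : Set G, IsCompact K' ∧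
      IsOpen U' ∧ 1 ∈ U' ∧ basicNhd K' U' D ⊆ basicNhd K U C}, ?_, ?_,
      ⟨K, U, hK, hU, h1, subset_rfl⟩⟩) h
    · rintro D ⟨K', U', -, -, h1', h'⟩
      exact h' (mem_basicNhd_self h1' D)
    · rintro D ⟨K', U', hK', hU', h1', h'⟩
      obtain ⟨V, hVo, hV1, hVV⟩ := exists_open_nhds_one_mul_subset (hU'.mem_nhds h1')
      obtain ⟨L, hL, hL1⟩ := exists_compact_mem_nhds (1 : G)
      obtain ⟨W, hWsub, hWo, hW1⟩ := mem_nhds_iff.1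
        (Filter.inter_mem (hVo.mem_nhds hV1) (Filter.inter_mem hL1 (inv_mem_nhds_one G hL1)))
      have key : ∀ {A B : Set G}, A ∩ (K' * L) ⊆ B * W → ∀ {E : Set G}, E ∩ K' ⊆ A * W →
          E ∩ K' ⊆ B * U' := by
        intro A B hAB E hEA x hx
        obtain ⟨a, ha, w, hw, rfl⟩ := hEA hx
        have haK : a ∈ K' * L :=
          ⟨a * w, hx.2, w⁻¹, (hWsub hw).2.2, by simp⟩
        obtain ⟨b, hb, w', hw', rfl⟩ := hAB ⟨ha, haK⟩
        exact ⟨b, hb, w' * w, hVV ⟨w', (hWsub hw').1, w, (hWsub hw).1, rfl⟩, by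
          simp [mul_assoc]⟩
      have hKL : K' ⊆ K' * L := fun x hx => ⟨x, hx, 1, mem_of_mem_nhds hL1, mul_one x⟩
      refine ⟨K' * L, W, hK'.mul hL, hWo, hW1, fun E hE => ?_⟩
      refine ⟨K' * L, W, hK'.mul hL, hWo, hW1, fun F hF => h' ⟨?_, ?_⟩⟩
      · exact key hE.1 fun x hx => hF.1 ⟨hx.1, hKL hx.2⟩
      · exact key hF.2 fun x hx => hE.2 ⟨hx.1, hKL hx.2⟩

/-- Borel `σ`-algebra of the Chabauty–Fell topology. -/
instance : MeasurableSpace (ClosedSubset G) := borel _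

instance : BorelSpace (ClosedSubset G) := ⟨rfl⟩

variable [IsTopologicalGroup G]

/-- The action of `G` on `𝒞(G)` by left translation. -/
instance : MulAction G (ClosedSubset G) where
  smul x C := mk (x • (C : Set G)) (C.isClosed.smul x)
  one_smul C := SetLike.coe_injective (one_smul G (C : Set G))
  mul_smul x y C := SetLike.coe_injective (mul_smul x y (C : Set G))

@[simp] theorem coe_smul (x : G) (C : ClosedSubset G) :
    ((x • C : ClosedSubset G) : Set G) = x • (C : Set G) := rfl

instance : ContinuousConstSMul G (ClosedSubset G) where
  continuous_const_smul x := by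
    refine continuous_def.2 fun O hO C hC => ?_
    obtain ⟨K, U, hK, hU, h1, h⟩ := hO _ hC
    refine ⟨x⁻¹ • K, U, hK.smul _, hU, h1, fun C' hC' => h ?_⟩
    have key : ∀ {A B : Set G}, A ∩ x⁻¹ • K ⊆ B * U → x • A ∩ K ⊆ x • B * U := by
      intro A B hAB y hy
      obtain ⟨a, ha, rfl⟩ := hy.1
      obtain ⟨b, hb, u, hu, hbu⟩ := hAB ⟨ha, x • a, hy.2, by simp⟩
      exact ⟨x • b, ⟨b, hb, rfl⟩, u, hu, by simp [← hbu, mul_assoc]⟩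
    exact ⟨key hC'.1, key hC'.2⟩

/-- The hull `Ω(Λ)`: the closure in `𝒞(G)` of the orbit `{x Λ : x ∈ G}`. -/
def hull (Λ : ClosedSubset G) : Set (ClosedSubset G) :=
  closure (Set.range fun x : G => x • Λ)

theorem smul_mem_hull {Λ Γ : ClosedSubset G} (x : G) (hΓ : Γ ∈ hull Λ) : x • Γ ∈ hull Λ := by
  refine map_mem_closure (continuous_const_smul x) hΓ ?_
  rintro _ ⟨y, rfl⟩
  exact ⟨x * y, mul_smul x y Λ⟩

/-- The action of `G` on the hull. -/
instance (Λ : ClosedSubset G) : MulAction G (hull Λ) where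
  smul x Γ := ⟨x • (Γ : ClosedSubset G), smul_mem_hull x Γ.2⟩
  one_smul Γ := Subtype.ext (one_smul G (Γ : ClosedSubset G))
  mul_smul x y Γ := Subtype.ext (mul_smul x y (Γ : ClosedSubset G))

@[simp] theorem hull_coe_smul {Λ : ClosedSubset G} (x : G) (Γ : hull Λ) :
    ((x • Γ : hull Λ) : ClosedSubset G) = x • (Γ : ClosedSubset G) := rfl

end ClosedSubset

/-- A Delone set, which is automatically closed, as a point of `𝒞(G)`. -/
def IsDelone.toClosed {G : Type*} [Group G] [TopologicalSpace G] [IsTopologicalGroup G]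
    [T1Space G] {Λ : Set G} (h : IsDelone Λ) : ClosedSubset G :=
  ClosedSubset.mk Λ h.isClosed

/-! ### Covolume -/

section Covolume

variable {G : Type*} [Group G] [TopologicalSpace G] [IsTopologicalGroup G]

/-- The periodization `(𝒫 f)(Γ) = ∑_{γ ∈ Γ} f(γ)` on the hull of `Λ`. -/
def periodization {Λ : ClosedSubset G} (f : G → ℝ) (Γ : ClosedSubset.hull Λ) : ℝ :=
  ∑' γ : ((Γ : ClosedSubset G) : Set G), f γ

variable [MeasurableSpace G]

/-- `c > 0` is the inverse of the proportionality constant between the functionals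
`f ↦ ∫ 𝒫 f dν` and `f ↦ ∫ f dμ` on `C_c(G)`. -/
def IsCovolume (μ : Measure G) {Λ : ClosedSubset G} (ν : Measure (ClosedSubset.hull Λ))
    (c : ℝ) : Prop :=
  0 < c ∧ ∀ f : G → ℝ, Continuous f → HasCompactSupport f →
    Integrable (periodization (Λ := Λ) f) ν ∧
      ∫ Γ, periodization f Γ ∂ν = c⁻¹ * ∫ x, f x ∂μ

/-- There is at most one such constant. -/
theorem IsCovolume.unique [LocallyCompactSpace G] [T2Space G] [BorelSpace G] {μ : Measure G}
    [μ.IsHaarMeasure] {Λ : ClosedSubset G}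
    {ν : Measure (ClosedSubset.hull Λ)} {c d : ℝ} (hc : IsCovolume μ ν c)
    (hd : IsCovolume μ ν d) : c = d := by
  obtain ⟨f, hf, hf0, hf1⟩ := exists_continuous_nonneg_pos (1 : G)
  have hpos : 0 < ∫ x, f x ∂μ := f.continuous.integral_pos_of_hasCompactSupport_nonneg_nonzero
    hf hf0 hf1
  have h := (hc.2 f f.continuous hf).2.symm.trans (hd.2 f f.continuous hf).2
  exact inv_injective (mul_right_cancel₀ hpos.ne' h)

open Classical in
/-- The covolume `covol_ν(Λ)` (with respect to the left Haar measure `μ`): the unique constant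
`c > 0` with `∫ 𝒫 f dν = c⁻¹ ∫ f dμ` for all `f ∈ C_c(G)`. -/
def covol (μ : Measure G) {Λ : ClosedSubset G} (ν : Measure (ClosedSubset.hull Λ)) : ℝ :=
  if h : ∃ c : ℝ, IsCovolume μ ν c then h.choose else 0

end Covolume

/-! ### Projective unitary representations and the wavelet transform -/

/-- A projective unitary representation of `G` on `H`: a strongly measurable map `π` into the
unitary operators on `H` with `π(e) = I` and `π(g₁) π(g₂) = σ(g₁, g₂) π(g₁ g₂)` for some
measurable `σ : G × G → 𝕋 ⊆ ℂ`. -/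
structure ProjectiveUnitaryRep (G H : Type*) [Group G] [MeasurableSpace G]
    [NormedAddCommGroup H] [InnerProductSpace ℂ H] where
  toFun : G → H ≃ₗᵢ[ℂ] H
  stronglyMeasurable' : ∀ f : H, StronglyMeasurable fun g => toFun g f
  map_one' : ∀ f : H, toFun 1 f = f
  exists_cocycle' : ∃ σ : G × G → ℂ, Measurable σ ∧ (∀ p, ‖σ p‖ = 1) ∧
    ∀ (g₁ g₂ : G) (f : H), toFun g₁ (toFun g₂ f) = σ (g₁, g₂) • toFun (g₁ * g₂) f

namespace ProjectiveUnitaryRep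

variable {G H : Type*} [Group G] [MeasurableSpace G] [NormedAddCommGroup H]
  [InnerProductSpace ℂ H]

instance : CoeFun (ProjectiveUnitaryRep G H) fun _ => G → H ≃ₗᵢ[ℂ] H := ⟨toFun⟩

/-- The wavelet transform `C_ψ f (g) = ⟨f, π(g) ψ⟩`, with `⟨·,·⟩` linear in the first argument
(Mathlib's `inner` is linear in the second one). -/
def waveletTransform (π : ProjectiveUnitaryRep G H) (ψ f : H) (g : G) : ℂ :=
  inner ℂ (π g ψ) f

end ProjectiveUnitaryRep

/-! ### The Wiener amalgam space `W(L²)` and the space `𝓑_π` -/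

section Wiener

variable {G H : Type*} [Group G] [MeasurableSpace G] [NormedAddCommGroup H]
  [InnerProductSpace ℂ H]

/-- The local maximal function `(M F)(g) = sup_{q ∈ Q} |F(g q)|`. -/
def localMaximal (Q : Set G) (F : G → ℂ) (g : G) : ℝ≥0∞ := ⨆ q ∈ Q, ‖F (g * q)‖ₑ

/-- `F ∈ W(L²)`: `F` is in `L^∞_loc(G)` and `M F` has finite `L²`-norm. -/
def MemWienerL2 [TopologicalSpace G] (μ : Measure G) (Q : Set G) (F : G → ℂ) : Prop :=
  (∀ K : Set G, IsCompact K → MemLp F ∞ (μ.restrict K)) ∧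
    ∫⁻ g, localMaximal Q F g ^ 2 ∂μ < ∞

/-- The space `𝓑_π` of all `ψ` with `C_ψ f ∈ W(L²)` for all `f`. -/
def spaceB [TopologicalSpace G] (μ : Measure G) (Q : Set G) (π : ProjectiveUnitaryRep G H) :
    Set H :=
  {ψ | ∀ f : H, MemWienerL2 μ Q (π.waveletTransform ψ f)}

end Wiener

/-! ### Bessel and lower frame bounds -/

section Frames

variable {H ι : Type*} [NormedAddCommGroup H] [InnerProductSpace ℂ H]

/-- The family `v` is a Bessel sequence with Bessel bound `C`:
`∑ᵢ |⟨f, vᵢ⟩|² ≤ C ‖f‖²` for all `f`. -/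
def IsBesselBound (v : ι → H) (C : ℝ) : Prop :=
  ∀ f : H, ∑' i, ‖inner ℂ (v i) f‖ₑ ^ 2 ≤ ENNReal.ofReal (C * ‖f‖ ^ 2)

/-- The family `v` admits the lower frame bound `C`: `C ‖f‖² ≤ ∑ᵢ |⟨f, vᵢ⟩|²` for all `f`. -/
def IsLowerFrameBound (v : ι → H) (C : ℝ) : Prop :=
  ∀ f : H, ENNReal.ofReal (C * ‖f‖ ^ 2) ≤ ∑' i, ‖inner ℂ (v i) f‖ₑ ^ 2

end Frames

end FrameCovol

end

open FrameCovol

/-! The defining identity of the covolume says that `∫ k dμ` is `covol` times the `ν`-average of the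
periodization of `k`, for `k ∈ C_c(G)`. Since `ν` has mass one, a bound on the periodization that is
uniform over the hull becomes a bound on `∫ k dμ`. The periodization is continuous and the orbit of
`Λ` is dense, so such a bound need only be checked at the translates `xΛ`. There the sum of `|C_ψ
f|²` is the frame sum of `π(x)⁻¹ f` over `Λ`, because phases do not affect absolute values, and
`π(x)⁻¹ f` has the norm of `f`.

The obstacle is that `|C_ψ f|²` is not compactly supported, so it is cut off to some `k ∈ C_c(G)`.
Its continuity comes from a Steinhaus argument (`eventually_exists_norm_sub_smul_lt`). For the
Bessel bound the cut-off only helps, and exhausting `G` by compact sets gives (i). For the lower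
bound the discarded tails must be small uniformly in `x`; this is where `ψ ∈ 𝓑_π` enters
(`exists_isCompact_tsum_indicator_le`).

The covolume exists by Riesz–Markov: averaging periodizations is a positive left-invariant
functional on `C_c(G)`, hence a multiple of Haar measure, and relative density of `Λ` makes the
multiple positive (`exists_isCovolume`). -/

namespace FrameCovol

open Set Filter
open scoped CompactlySupported

namespace ClosedSubset

/-! ### Hit and miss sets, and what the hull inherits from the orbit. -/

section Topology

variable {G : Type*} [Group G] [TopologicalSpace G] [IsTopologicalGroup G]

theorem isOpen_setOf_inter_nonempty {O : Set G} (hO : IsOpen O) :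
    IsOpen {C : ClosedSubset G | ((C : Set G) ∩ O).Nonempty} := by
  rintro C ⟨x, hxC, hxO⟩
  have hcont : Continuous fun v : G => x * v⁻¹ := by fun_prop
  refine ⟨{x}, (fun v : G => x * v⁻¹) ⁻¹' O, isCompact_singleton, hO.preimage hcont,
    by simpa using hxO, fun C' hC' => ?_⟩
  obtain ⟨y, hy, v, hv, hyv⟩ := hC'.2 ⟨hxC, mem_singleton x⟩
  have hyv : y * v = x := hyv
  exact ⟨y, hy, by rwa [mem_preimage, ← hyv, mul_inv_cancel_right] at hv⟩

/-- Compactness gives one `V` with `K V` still disjoint from `C`; a nearby `C'` meeting `K` would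
put a point of `C` in `K V`. -/
theorem isOpen_setOf_disjoint {K : Set G} (hK : IsCompact K) :
    IsOpen {C : ClosedSubset G | Disjoint (C : Set G) K} := by
  intro C hC
  obtain ⟨V, hV, hKV⟩ := compact_open_separated_mul_right hK C.isClosed.isOpen_compl
    (subset_compl_iff_disjoint_left.2 hC)
  obtain ⟨W, hWV, hWo, hW1⟩ := mem_nhds_iff.1 hV
  refine ⟨K, W⁻¹, hK, hWo.inv, by simpa using hW1, fun C' hC' => disjoint_left.2 fun x hx hxK => ?_⟩
  obtain ⟨c, hc, w, hw, hcw⟩ := hC'.1 ⟨hx, hxK⟩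
  have hcw : c * w = x := hcw
  exact hKV ⟨x, hxK, w⁻¹, hWV hw, by simp [← hcw]⟩ hc

instance (Λ : ClosedSubset G) : ContinuousConstSMul G (hull Λ) where
  continuous_const_smul x :=
    Continuous.subtype_mk ((continuous_const_smul x).comp continuous_subtype_val) _

/-- The orbit of `Λ` is dense in its hull. -/
theorem exists_smul_mem_of_isOpen {Λ : ClosedSubset G} {O : Set (hull Λ)} (hO : IsOpen O)
    (hne : O.Nonempty) :
    ∃ x : G, ∃ h : x • Λ ∈ hull Λ, (⟨x • Λ, h⟩ : hull Λ) ∈ O := by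
  obtain ⟨Γ, hΓ⟩ := hne
  obtain ⟨O', hO', rfl⟩ := isOpen_induced_iff.1 hO
  obtain ⟨_, hx, x, rfl⟩ := mem_closure_iff.1 Γ.2 O' hO' hΓ
  exact ⟨x, subset_closure ⟨x, rfl⟩, hx⟩

/-- A closed condition that holds on the orbit of `Λ` holds on the hull. -/
theorem hull_induction {Λ : ClosedSubset G} {p : hull Λ → Prop} (hp : IsClosed {Γ | p Γ})
    (h : ∀ (x : G) (hx : x • Λ ∈ hull Λ), p ⟨x • Λ, hx⟩) (Γ : hull Λ) : p Γ := by
  by_contra hΓ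
  obtain ⟨x, hx, hO⟩ := exists_smul_mem_of_isOpen hp.isOpen_compl ⟨Γ, hΓ⟩
  exact hO (h x hx)

theorem isSeparatedBy_smul {Λ : ClosedSubset G} {U : Set G} (hΛ : IsSeparatedBy U (Λ : Set G))
    (x : G) : IsSeparatedBy U ((x • Λ : ClosedSubset G) : Set G) := by
  rintro g _ ⟨⟨a, ha, rfl⟩, haU⟩ _ ⟨⟨b, hb, rfl⟩, hbU⟩
  have key : ∀ c : G, x • c ∈ g • U → c ∈ (x⁻¹ * g) • U := fun c hc => by
    rw [mul_smul, mem_inv_smul_set_iff]; exact hc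
  exact congrArg _ (hΛ (x⁻¹ * g) ⟨ha, key a haU⟩ ⟨hb, key b hbU⟩)

/-- Two distinct points of `Γ` in `gU` are recorded by two open hit conditions with disjoint
targets, so some translate of `Λ` would also have two points in `gU`. -/
theorem isSeparatedBy_of_mem_hull [T2Space G] {Λ Γ : ClosedSubset G} {U : Set G} (hU : IsOpen U)
    (hΛ : IsSeparatedBy U (Λ : Set G)) (hΓ : Γ ∈ hull Λ) : IsSeparatedBy U (Γ : Set G) := by
  rintro g a ⟨haΓ, haU⟩ b ⟨hbΓ, hbU⟩
  by_contra hab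
  obtain ⟨A, B, hA, hB, haA, hbB, hAB⟩ := t2_separation hab
  have hgU : IsOpen (g • U) := hU.smul g
  obtain ⟨_, ⟨⟨y, hy, hyA⟩, z, hz, hzB⟩, x, rfl⟩ := mem_closure_iff.1 hΓ _
    ((isOpen_setOf_inter_nonempty (hA.inter hgU)).inter
      (isOpen_setOf_inter_nonempty (hB.inter hgU)))
    ⟨⟨a, haΓ, haA, haU⟩, ⟨b, hbΓ, hbB, hbU⟩⟩
  have := isSeparatedBy_smul hΛ x g ⟨hy, hyA.2⟩ ⟨hz, hzB.2⟩
  exact disjoint_left.1 hAB hyA.1 (this ▸ hzB.1)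

end Topology

end ClosedSubset

open ClosedSubset

/-! ### Continuity and boundedness of periodizations. -/

section Periodization

variable {G : Type*} [Group G] [TopologicalSpace G] [IsTopologicalGroup G]

theorem periodization_smul {Λ : ClosedSubset G} (f : G → ℝ) (x : G) (Γ : hull Λ) :
    periodization f (x • Γ) = periodization (fun g => f (x * g)) Γ := by
  let e : ((Γ : ClosedSubset G) : Set G) ≃ (((x • Γ : hull Λ) : ClosedSubset G) : Set G) :=
    (Equiv.refl G).trans (MulAction.toPerm x) |>.image _ |>.trans (Equiv.setCongr rfl)
  exact (e.tsum_eq fun γ => f γ).symm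

theorem periodization_nonneg {Λ : ClosedSubset G} {f : G → ℝ} (hf : ∀ x, 0 ≤ f x) (Γ : hull Λ) :
    0 ≤ periodization f Γ :=
  tsum_nonneg fun γ => hf γ

theorem periodization_neg {Λ : ClosedSubset G} (f : G → ℝ) (Γ : hull Λ) :
    periodization (-f) Γ = -periodization f Γ :=
  tsum_neg

theorem periodization_eq_zero {Λ : ClosedSubset G} {f : G → ℝ} {Γ : hull Λ}
    (h : ∀ γ ∈ (Γ : ClosedSubset G), f γ = 0) : periodization f Γ = 0 := by
  have : (fun γ : ((Γ : ClosedSubset G) : Set G) => f γ) = 0 := funext fun γ => h γ γ.2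
  rw [periodization, this]; exact tsum_zero

variable [T2Space G] {Λ : ClosedSubset G} {U : Set G}

theorem eq_zero_of_support_subset_smul (hU : IsOpen U)
    (hΛ : IsSeparatedBy U (Λ : Set G)) {f : G → ℝ} {g : G} (hfU : Function.support f ⊆ g • U)
    (Γ : hull Λ) {γ : G} (hγ : γ ∈ (Γ : ClosedSubset G)) (hfγ : f γ ≠ 0)
    {δ : G} (hδ : δ ∈ (Γ : ClosedSubset G)) (hδγ : δ ≠ γ) : f δ = 0 := by
  by_contra h
  exact hδγ (isSeparatedBy_of_mem_hull hU hΛ Γ.2 g ⟨hδ, hfU h⟩ ⟨hγ, hfU hfγ⟩)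

theorem periodization_eq_of_support_subset_smul (hU : IsOpen U)
    (hΛ : IsSeparatedBy U (Λ : Set G)) {f : G → ℝ} {g : G} (hfU : Function.support f ⊆ g • U)
    (Γ : hull Λ) {γ : G} (hγ : γ ∈ (Γ : ClosedSubset G)) (hfγ : f γ ≠ 0) :
    periodization f Γ = f γ :=
  tsum_eq_single (⟨γ, hγ⟩ : ((Γ : ClosedSubset G) : Set G)) fun δ hδ =>
    eq_zero_of_support_subset_smul hU hΛ hfU Γ hγ hfγ δ.2
      fun h => hδ (Subtype.ext h)

theorem summable_of_support_subset_smul (hU : IsOpen U)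
    (hΛ : IsSeparatedBy U (Λ : Set G)) {f : G → ℝ} {g : G} (hfU : Function.support f ⊆ g • U)
    (Γ : hull Λ) : Summable fun γ : ((Γ : ClosedSubset G) : Set G) => f γ := by
  refine summable_of_hasFiniteSupport (Set.Subsingleton.finite fun γ hγ δ hδ => ?_)
  exact Subtype.ext (isSeparatedBy_of_mem_hull hU hΛ Γ.2 g ⟨γ.2, hfU hγ⟩ ⟨δ.2, hfU hδ⟩)

/-- At most one term of the sum is nonzero. Hence for `t ≥ 0` the condition says that `Γ` hits the
open set `{f > t}`, and for `t < 0` that it misses the compact set `{f ≤ t}`. -/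
theorem isOpen_lt_periodization_of_support_subset_smul (hU : IsOpen U)
    (hΛ : IsSeparatedBy U (Λ : Set G)) {f : G → ℝ} (hf : Continuous f) (hfc : HasCompactSupport f)
    {g : G} (hfU : Function.support f ⊆ g • U) (t : ℝ) :
    IsOpen {Γ : hull Λ | t < periodization f Γ} := by
  rcases le_or_gt 0 t with ht | ht
  · convert (isOpen_setOf_inter_nonempty (isOpen_lt continuous_const hf)).preimage
      (continuous_subtype_val (p := (· ∈ hull Λ))) using 1
    ext Γ
    simp only [mem_ofPred_eq, mem_preimage]
    constructor
    · intro h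
      by_contra hne
      have hle : ∀ γ ∈ (Γ : ClosedSubset G), f γ ≤ t := fun γ hγ =>
        not_lt.1 fun hlt => hne ⟨γ, hγ, hlt⟩
      by_cases hz : ∀ γ ∈ (Γ : ClosedSubset G), f γ = 0
      · rw [periodization_eq_zero hz] at h
        exact absurd h (not_lt.2 ht)
      · push Not at hz
        obtain ⟨γ, hγ, hfγ⟩ := hz
        rw [periodization_eq_of_support_subset_smul hU hΛ hfU Γ hγ hfγ] at h
        exact absurd h (not_lt.2 (hle γ hγ))
    · rintro ⟨γ, hγ, hlt⟩
      have hlt : t < f γ := hlt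
      rwa [periodization_eq_of_support_subset_smul hU hΛ hfU Γ hγ (ht.trans_lt hlt).ne']
  · have hK : IsCompact {x | f x ≤ t} :=
      hfc.of_isClosed_subset (isClosed_le hf continuous_const) fun x hx =>
        subset_tsupport _ (lt_of_le_of_lt hx ht).ne
    convert (isOpen_setOf_disjoint hK).preimage
      (continuous_subtype_val (p := (· ∈ hull Λ))) using 1
    ext Γ
    simp only [mem_ofPred_eq, mem_preimage]
    constructor
    · intro h
      refine disjoint_left.2 fun γ hγ hγt => ?_
      have hγt : f γ ≤ t := hγt
      rw [periodization_eq_of_support_subset_smul hU hΛ hfU Γ hγ (hγt.trans_lt ht).ne] at h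
      exact absurd h (not_lt.2 hγt)
    · intro h
      by_cases hz : ∀ γ ∈ (Γ : ClosedSubset G), f γ = 0
      · rwa [periodization_eq_zero hz]
      · push Not at hz
        obtain ⟨γ, hγ, hfγ⟩ := hz
        rw [periodization_eq_of_support_subset_smul hU hΛ hfU Γ hγ hfγ]
        exact not_le.1 fun hle => disjoint_left.1 h hγ hle

theorem continuous_periodization_of_support_subset_smul (hU : IsOpen U)
    (hΛ : IsSeparatedBy U (Λ : Set G)) {f : G → ℝ} (hf : Continuous f) (hfc : HasCompactSupport f)
    {g : G} (hfU : Function.support f ⊆ g • U) :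
    Continuous (periodization (Λ := Λ) f) := by
  refine OrderTopology.continuous_iff.2 fun t =>
    ⟨isOpen_lt_periodization_of_support_subset_smul hU hΛ hf hfc hfU t, ?_⟩
  -- Upper semicontinuity is lower semicontinuity for `-f`.
  have := isOpen_lt_periodization_of_support_subset_smul hU hΛ (f := -f) hf.neg
    (hfc.comp_left (g := Neg.neg) neg_zero) (g := g) (by rwa [Function.support_neg]) (-t)
  simp only [periodization_neg, neg_lt_neg_iff] at this
  exact this

theorem norm_periodization_le_of_support_subset_smul (hU : IsOpen U)
    (hΛ : IsSeparatedBy U (Λ : Set G)) {f : G → ℝ} {C : ℝ} (hC : ∀ x, ‖f x‖ ≤ C)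
    {g : G} (hfU : Function.support f ⊆ g • U) (Γ : hull Λ) : ‖periodization f Γ‖ ≤ C := by
  by_cases hz : ∀ γ ∈ (Γ : ClosedSubset G), f γ = 0
  · rw [periodization_eq_zero hz, norm_zero]
    exact (norm_nonneg _).trans (hC 1)
  · push Not at hz
    obtain ⟨γ, hγ, hfγ⟩ := hz
    rw [periodization_eq_of_support_subset_smul hU hΛ hfU Γ hγ hfγ]
    exact hC γ

/-- Every function in `C_c(G)` is a finite sum of functions in `C_c(G)` that are supported in
translates of a given nonempty open set. -/
theorem exists_eq_sum_support_subset_smul [LocallyCompactSpace G] (hU : IsOpen U)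
    (hne : U.Nonempty) {f : G → ℝ} (hf : Continuous f) (hfc : HasCompactSupport f) :
    ∃ (n : ℕ) (h : Fin n → G → ℝ), (∀ i, Continuous (h i)) ∧ (∀ i, HasCompactSupport (h i)) ∧
      (∀ i, ∃ g : G, Function.support (h i) ⊆ g • U) ∧ ∀ x, f x = ∑ i, h i x := by
  obtain ⟨u, hu⟩ := hne
  obtain ⟨s, hs⟩ := hfc.isCompact.elim_finite_subcover (fun g : G => g • U) (fun g => hU.smul g)
    fun x _ => mem_iUnion.2 ⟨x * u⁻¹, u, hu, by simp⟩
  let e := s.equivFin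
  obtain ⟨p, hpU, hp1, -, -⟩ := exists_continuous_sum_one_of_isOpen_isCompact
    (s := fun i => (e.symm i : G) • U) (fun i => hU.smul _) hfc.isCompact (fun x hx => by
      obtain ⟨g, hg, hxg⟩ := mem_iUnion₂.1 (hs hx)
      exact mem_iUnion.2 ⟨e ⟨g, hg⟩, by simpa using hxg⟩)
  refine ⟨_, fun i x => f x * p i x, fun i => hf.mul (p i).continuous, fun i => hfc.mul_right,
    fun i => ⟨e.symm i, fun x hx => hpU i (subset_tsupport _ (right_ne_zero_of_mul hx))⟩,
    fun x => ?_⟩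
  rw [← Finset.mul_sum]
  by_cases hx : x ∈ tsupport f
  · have := hp1 hx
    simp only [Finset.sum_apply, Pi.one_apply] at this
    rw [this, mul_one]
  · rw [image_eq_zero_of_notMem_tsupport hx, zero_mul]

section

variable [LocallyCompactSpace G]

theorem summable_periodization (hU : IsOpen U) (hne : U.Nonempty)
    (hΛ : IsSeparatedBy U (Λ : Set G)) {f : G → ℝ} (hf : Continuous f)
    (hfc : HasCompactSupport f) (Γ : hull Λ) :
    Summable fun γ : ((Γ : ClosedSubset G) : Set G) => f γ := by
  obtain ⟨n, h, -, -, hg, hsum⟩ := exists_eq_sum_support_subset_smul hU hne hf hfc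
  simp only [hsum]
  exact summable_sum fun i _ => summable_of_support_subset_smul hU hΛ (hg i).choose_spec Γ

theorem continuous_periodization (hU : IsOpen U) (hne : U.Nonempty)
    (hΛ : IsSeparatedBy U (Λ : Set G)) {f : G → ℝ} (hf : Continuous f)
    (hfc : HasCompactSupport f) : Continuous (periodization (Λ := Λ) f) := by
  obtain ⟨n, h, hc, hcs, hg, hsum⟩ := exists_eq_sum_support_subset_smul hU hne hf hfc
  have : periodization (Λ := Λ) f = fun Γ => ∑ i, periodization (h i) Γ := by
    funext Γ
    simp only [periodization, hsum]
    exact Summable.tsum_finsetSum fun i _ =>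
      summable_of_support_subset_smul hU hΛ (hg i).choose_spec Γ
  rw [this]
  exact continuous_finsetSum _ fun i _ => continuous_periodization_of_support_subset_smul hU hΛ
    (hc i) (hcs i) (hg i).choose_spec

theorem exists_norm_periodization_le (hU : IsOpen U) (hne : U.Nonempty)
    (hΛ : IsSeparatedBy U (Λ : Set G)) {f : G → ℝ} (hf : Continuous f)
    (hfc : HasCompactSupport f) : ∃ C, ∀ Γ : hull Λ, ‖periodization f Γ‖ ≤ C := by
  obtain ⟨n, h, hc, hcs, hg, hsum⟩ := exists_eq_sum_support_subset_smul hU hne hf hfc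
  choose C hC using fun i => (hcs i).exists_bound_of_continuous (hc i)
  refine ⟨∑ i, C i, fun Γ => ?_⟩
  have : periodization f Γ = ∑ i, periodization (h i) Γ := by
    simp only [periodization, hsum]
    exact Summable.tsum_finsetSum fun i _ =>
      summable_of_support_subset_smul hU hΛ (hg i).choose_spec Γ
  rw [this]
  exact norm_sum_le_of_le _ fun i _ => norm_periodization_le_of_support_subset_smul hU hΛ (hC i)
    (hg i).choose_spec Γ

theorem integrable_periodization (hU : IsOpen U) (hne : U.Nonempty)
    (hΛ : IsSeparatedBy U (Λ : Set G)) {f : G → ℝ} (hf : Continuous f)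
    (hfc : HasCompactSupport f) (ν : Measure (hull Λ)) [IsFiniteMeasure ν] :
    Integrable (periodization (Λ := Λ) f) ν := by
  obtain ⟨C, hC⟩ := exists_norm_periodization_le hU hne hΛ hf hfc
  exact .of_bound (continuous_periodization hU hne hΛ hf hfc).measurable.aestronglyMeasurable C
    (ae_of_all _ hC)

end

end Periodization

/-! ### Existence of the covolume. -/

section Covolume

variable {G : Type*} [Group G] [TopologicalSpace G] [IsTopologicalGroup G]
  [LocallyCompactSpace G] [T2Space G]

/-- The positive linear functional `f ↦ ∫ 𝒫 f dν` on `C_c(G)`. -/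
noncomputable def periodizationFunctional {Λ : ClosedSubset G} {U : Set G} (hU : IsOpen U)
    (hne : U.Nonempty) (hΛ : IsSeparatedBy U (Λ : Set G)) (ν : Measure (hull Λ))
    [IsFiniteMeasure ν] : C_c(G, ℝ) →ₚ[ℝ] ℝ :=
  PositiveLinearMap.mk₀
    { toFun := fun f => ∫ Γ, periodization f Γ ∂ν
      map_add' := fun f g => by
        refine Eq.trans (integral_congr_ae (ae_of_all _ fun Γ => ?_)) (integral_add
          (integrable_periodization hU hne hΛ f.continuous f.hasCompactSupport ν)
          (integrable_periodization hU hne hΛ g.continuous g.hasCompactSupport ν))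
        exact (summable_periodization hU hne hΛ f.continuous f.hasCompactSupport Γ).tsum_add
          (summable_periodization hU hne hΛ g.continuous g.hasCompactSupport Γ)
      map_smul' := fun c f => by
        rw [RingHom.id_apply, smul_eq_mul, ← integral_const_mul]
        exact integral_congr_ae (ae_of_all _ fun Γ => tsum_mul_left) }
    fun _ hf => integral_nonneg fun Γ => periodization_nonneg hf Γ

variable [MeasurableSpace G] [BorelSpace G]

/-- The Riesz measure of `periodizationFunctional` is left invariant because `ν` is, so it is `r •
μ` on `C_c(G)`; the covolume is `r⁻¹`. -/
theorem exists_isCovolume (μ : Measure G) [μ.IsHaarMeasure] {Λ : ClosedSubset G}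
    (hΛ : IsDelone (Λ : Set G)) (ν : Measure (hull Λ)) [IsProbabilityMeasure ν]
    [SMulInvariantMeasure G (hull Λ) ν] : ∃ c, IsCovolume μ ν c := by
  obtain ⟨⟨U, hU, hne, hsep⟩, K, hK, hdense⟩ := hΛ
  set m : Measure G := RealRMK.rieszMeasure (periodizationFunctional hU hne hsep ν) with hm
  have hint : ∀ f : G → ℝ, Continuous f → HasCompactSupport f →
      ∫ x, f x ∂m = ∫ Γ, periodization f Γ ∂ν := fun f hf hfc =>
    RealRMK.integral_rieszMeasure (periodizationFunctional hU hne hsep ν)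
      ⟨⟨f, hf⟩, hfc⟩
  have hreg : m.Regular := inferInstance
  have hinv : m.IsMulLeftInvariant := by
    refine ⟨fun x => ?_⟩
    -- Integrals over `C_c(G)` determine a measure only among regular ones.
    have : (Measure.map (x * ·) m).Regular := Measure.Regular.map (Homeomorph.mulLeft x)
    refine Measure.ext_of_integral_eq_on_compactlySupported fun f => ?_
    have hcont : Continuous fun g => f (x * g) := f.continuous.comp (continuous_const_mul x)
    have hcs : HasCompactSupport fun g => f (x * g) :=
      f.hasCompactSupport.comp_homeomorph (Homeomorph.mulLeft x)
    calc ∫ y, f y ∂(Measure.map (x * ·) m) = ∫ y, f (x * y) ∂m :=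
          (Homeomorph.mulLeft x).measurableEmbedding.integral_map f
      _ = ∫ Γ, periodization (fun g => f (x * g)) Γ ∂ν := hint _ hcont hcs
      _ = ∫ Γ, periodization f (x • Γ) ∂ν := by simp only [periodization_smul]
      _ = ∫ Γ, periodization f Γ ∂ν := integral_smul_eq_self _
      _ = ∫ y, f y ∂m := (hint _ f.continuous f.hasCompactSupport).symm
  have hfin : IsFiniteMeasureOnCompacts m := inferInstance
  set r := Measure.haarScalarFactor m μ
  have hr : ∀ f : G → ℝ, Continuous f → HasCompactSupport f →
      ∫ Γ, periodization f Γ ∂ν = r * ∫ x, f x ∂μ := fun f hf hfc => by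
    rw [← hint f hf hfc, Measure.integral_isMulLeftInvariant_eq_smul_of_hasCompactSupport m μ hf
      hfc, integral_smul_nnreal_measure]
    rfl
  -- Every translate of `Λ` meets `K`, so a bump function equal to one on `K` has periodization at
  -- least one on the orbit, hence on the hull. This rules out `r = 0`.
  obtain ⟨f, hf1, -, hfc, hf01⟩ := exists_continuous_one_zero_of_isCompact hK isClosed_empty
    (disjoint_empty K)
  have hone : ∀ Γ : hull Λ, 1 ≤ periodization f Γ := by
    refine hull_induction (isClosed_le continuous_const
      (continuous_periodization hU hne hsep f.continuous hfc)) fun x hx => ?_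
    obtain ⟨l, hl, k, hk, hkl⟩ := hdense x⁻¹
    have hkl : x⁻¹ * k = l := hkl
    have hk' : k ∈ ((x • Λ : ClosedSubset G) : Set G) := ⟨l, hl, by simp [← hkl]⟩
    calc (1 : ℝ) = f k := (hf1 hk).symm
      _ ≤ _ := (summable_periodization hU hne hsep f.continuous hfc ⟨x • Λ, hx⟩).le_tsum
        (⟨k, hk'⟩ : ((x • Λ : ClosedSubset G) : Set G)) fun γ _ => (hf01 γ).1
  have hrpos : 0 < (r : ℝ) := by
    have h1 : (1 : ℝ) ≤ ∫ Γ, periodization f Γ ∂ν := by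
      simpa using integral_mono (integrable_const (1 : ℝ))
        (integrable_periodization hU hne hsep f.continuous hfc ν) hone
    rw [hr f f.continuous hfc] at h1
    refine lt_of_le_of_ne r.2 fun h0 => ?_
    rw [← h0, zero_mul] at h1
    exact absurd h1 (by norm_num)
  exact ⟨(r : ℝ)⁻¹, inv_pos.2 hrpos, fun f hf hfc =>
    ⟨integrable_periodization hU hne hsep hf hfc ν, by rw [inv_inv, hr f hf hfc]⟩⟩

theorem isCovolume_covol (μ : Measure G) [μ.IsHaarMeasure] {Λ : ClosedSubset G}
    (hΛ : IsDelone (Λ : Set G)) (ν : Measure (hull Λ)) [IsProbabilityMeasure ν]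
    [SMulInvariantMeasure G (hull Λ) ν] : IsCovolume μ ν (covol μ ν) := by
  have h := exists_isCovolume μ hΛ ν
  rw [covol, dif_pos h]
  exact h.choose_spec

end Covolume

/-! ### Covariance and continuity of `|C_ψ f|`. -/

namespace ProjectiveUnitaryRep

variable {G H : Type*} [Group G] [MeasurableSpace G] [NormedAddCommGroup H]
  [InnerProductSpace ℂ H] (π : ProjectiveUnitaryRep G H)

theorem exists_norm_eq_one_mul (g h : G) :
    ∃ z : ℂ, ‖z‖ = 1 ∧ ∀ f : H, π g (π h f) = z • π (g * h) f := by
  obtain ⟨σ, -, h1, hσ⟩ := π.exists_cocycle'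
  exact ⟨σ (g, h), h1 _, hσ g h⟩

/-- `|⟨f, π(g h) ψ⟩| = |⟨π(g)⁻¹ f, π(h) ψ⟩|`. -/
theorem norm_waveletTransform_mul (ψ f : H) (g h : G) :
    ‖π.waveletTransform ψ f (g * h)‖ = ‖π.waveletTransform ψ ((π g).symm f) h‖ := by
  obtain ⟨z, hz, hzmul⟩ := π.exists_norm_eq_one_mul g h
  have : inner ℂ (π h ψ) ((π g).symm f) = inner ℂ (π g (π h ψ)) f := by
    rw [← (π g).inner_map_map, (π g).apply_symm_apply]
  rw [waveletTransform, waveletTransform, this, hzmul, inner_smul_left, norm_mul, RCLike.norm_conj,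
    hz, one_mul]

variable [TopologicalSpace G] [IsTopologicalGroup G] [LocallyCompactSpace G]
  [SecondCountableTopology G] [T2Space G] [BorelSpace G]

/-- A measurable projective representation is continuous at the identity, up to phases. -/
theorem eventually_exists_norm_sub_smul_lt (ψ : H) {ε : ℝ} (hε : 0 < ε) :
    ∀ᶠ h in 𝓝 (1 : G), ∃ z : ℂ, ‖z‖ = 1 ∧ ‖π h ψ - z • ψ‖ < ε := by
  let μ : Measure G := Measure.haar
  have hmeas : StronglyMeasurable fun g => π g⁻¹ ψ :=
    (π.stronglyMeasurable' ψ).comp_measurable measurable_inv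
  obtain ⟨c, hc, hdense⟩ := hmeas.isSeparable_range
  -- Inverses are used so that `π(a⁻¹)` carries `π(a b⁻¹) ψ` to a multiple of `π(b⁻¹) ψ`, for `a`
  -- and `b` in the same set.
  let E : H → Set G := fun w => {g | ‖π g⁻¹ ψ - w‖ < ε / 2}
  have hE : ∀ w, MeasurableSet (E w) := fun w =>
    (hmeas.sub stronglyMeasurable_const).norm.measurable measurableSet_Iio
  have hcover : ⋃ w ∈ c, E w = univ := by
    refine eq_univ_of_forall fun g => ?_
    obtain ⟨w, hw, hgw⟩ := Metric.mem_closure_iff.1 (hdense ⟨g, rfl⟩) (ε / 2) (half_pos hε)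
    exact mem_iUnion₂.2 ⟨w, hw, by rwa [dist_eq_norm] at hgw⟩
  -- Countably many of these sets cover `G`, so one has positive measure, and by Steinhaus its
  -- quotient set is a neighbourhood of the identity.
  obtain ⟨w, -, hw⟩ : ∃ w ∈ c, μ (E w) ≠ 0 := by
    by_contra! h
    have := (measure_biUnion_null_iff hc).2 h
    rw [hcover] at this
    exact (NeZero.ne (μ univ)) this
  have : μ.InnerRegular := inferInstance
  filter_upwards [Measure.div_mem_nhds_one_of_haar_pos μ (E w) (hE w) (pos_iff_ne_zero.2 hw)]
  rintro _ ⟨a, ha, b, hb, rfl⟩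
  obtain ⟨z, hz, hzmul⟩ := π.exists_norm_eq_one_mul a⁻¹ (a / b)
  refine ⟨z, hz, ?_⟩
  have hmul : a⁻¹ * (a / b) = b⁻¹ := by simp [div_eq_mul_inv]
  have ha : ‖π a⁻¹ ψ - w‖ < ε / 2 := ha
  have hb : ‖π b⁻¹ ψ - w‖ < ε / 2 := hb
  calc ‖π (a / b) ψ - z • ψ‖ = ‖π a⁻¹ (π (a / b) ψ - z • ψ)‖ := ((π a⁻¹).norm_map _).symm
    _ = ‖z • (π b⁻¹ ψ - π a⁻¹ ψ)‖ := by rw [map_sub, hzmul, hmul, map_smul, smul_sub]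
    _ = ‖(π b⁻¹ ψ - w) - (π a⁻¹ ψ - w)‖ := by rw [norm_smul, hz, one_mul, sub_sub_sub_cancel_right]
    _ < ε := by linarith [norm_sub_le (π b⁻¹ ψ - w) (π a⁻¹ ψ - w)]

/-- Covariance moves the question to the identity, where `π(h) ψ` is close to a unimodular multiple
of `ψ`, and the modulus ignores the multiple. -/
theorem continuous_norm_waveletTransform (ψ f : H) :
    Continuous fun g => ‖π.waveletTransform ψ f g‖ := by
  refine continuous_iff_continuousAt.2 fun g => Metric.tendsto_nhds.2 fun ε hε => ?_
  have h1 : ∀ᶠ x in 𝓝 g, ∃ z : ℂ, ‖z‖ = 1 ∧ ‖π (g⁻¹ * x) ψ - z • ψ‖ < ε / (‖f‖ + 1) := by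
    have : Tendsto (fun x => g⁻¹ * x) (𝓝 g) (𝓝 1) := by
      simpa using (continuous_const_mul g⁻¹).tendsto g
    exact this.eventually (π.eventually_exists_norm_sub_smul_lt ψ (by positivity))
  filter_upwards [h1] with x ⟨z, hz, hx⟩
  have hgx : ‖π.waveletTransform ψ f x‖ = ‖inner ℂ (π (g⁻¹ * x) ψ) ((π g).symm f)‖ := by
    rw [← mul_inv_cancel_left g x, norm_waveletTransform_mul, mul_inv_cancel_left]; rfl
  have hg : ‖π.waveletTransform ψ f g‖ = ‖inner ℂ (z • ψ) ((π g).symm f)‖ := by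
    rw [← mul_one g, norm_waveletTransform_mul, mul_one, waveletTransform, π.map_one',
      inner_smul_left, norm_mul, RCLike.norm_conj, hz, one_mul]
  rw [hgx, hg, Real.dist_eq]
  calc _ ≤ ‖inner ℂ (π (g⁻¹ * x) ψ) ((π g).symm f) - inner ℂ (z • ψ) ((π g).symm f)‖ :=
        abs_norm_sub_norm_le _ _
    _ ≤ ‖π (g⁻¹ * x) ψ - z • ψ‖ * ‖f‖ := by
        rw [← inner_sub_left, ← (π g).symm.norm_map f]
        exact norm_inner_le_norm _ _
    _ ≤ ε / (‖f‖ + 1) * ‖f‖ := by gcongr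
    _ < ε := by
        rw [div_mul_eq_mul_div, div_lt_iff₀ (by positivity)]
        nlinarith

end ProjectiveUnitaryRep

/-! ### Uniform tails from the local maximal function. -/

section Tails

variable {G : Type*} [Group G] [TopologicalSpace G] [IsTopologicalGroup G]

theorem lowerSemicontinuous_localMaximal (Q : Set G) {F : G → ℂ}
    (hF : Continuous fun g => ‖F g‖) : LowerSemicontinuous (localMaximal Q F) := by
  refine lowerSemicontinuous_biSup fun q _ => Continuous.lowerSemicontinuous ?_
  simp only [← ofReal_norm]
  exact ENNReal.continuous_ofReal.comp (hF.comp (continuous_mul_const q))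

variable [LocallyCompactSpace G] [SecondCountableTopology G] [T2Space G]
  [MeasurableSpace G] [BorelSpace G]

/-- If the local maximal function of `F` is square integrable, then the sums of `|F|²` over
separated sets have uniformly small tails. -/
theorem exists_isCompact_tsum_indicator_le (μ : Measure G) [μ.IsHaarMeasure] {Q : Set G}
    (hQ : IsCompact Q) (hQ1 : Q ∈ 𝓝 (1 : G)) {U : Set G} (hU : IsOpen U) (hne : U.Nonempty)
    {F : G → ℂ} (hF : Continuous fun g => ‖F g‖)
    (hfin : ∫⁻ g, localMaximal Q F g ^ 2 ∂μ < ∞) {ε : ℝ≥0∞} (hε : ε ≠ 0) :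
    ∃ K : Set G, IsCompact K ∧ ∀ Γ : Set G, IsSeparatedBy U Γ →
      ∑' γ : Γ, Kᶜ.indicator (fun g => ‖F g‖ₑ ^ 2) γ ≤ ε := by
  obtain ⟨u, hu⟩ := hne
  have hU1 : u⁻¹ • U ∈ 𝓝 (1 : G) := (hU.smul u⁻¹).mem_nhds ⟨u, hu, by simp⟩
  -- `A ⊆ Q⁻¹` makes the maximal function dominate `|F(γ)|` on `γA`, as `γ = (γa)a⁻¹`; `A ⊆
  -- (u⁻¹U)⁻¹` makes the sets `γA` disjoint for separated `γ`.
  obtain ⟨A, hAsub, hAo, hA1⟩ := mem_nhds_iff.1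
    (inter_mem (inv_mem_nhds_one G hQ1) (inv_mem_nhds_one G hU1))
  have hAtop : μ A ≠ ∞ :=
    ((measure_mono fun a ha => (hAsub ha).1).trans_lt hQ.inv.measure_lt_top).ne
  have hA0 : μ A ≠ 0 := (hAo.measure_pos μ ⟨1, hA1⟩).ne'
  set M : G → ℝ≥0∞ := fun g => localMaximal Q F g ^ 2 with hM
  have hMmeas : Measurable M := (lowerSemicontinuous_localMaximal Q hF).measurable.pow_const 2
  set m : Measure G := μ.withDensity M with hm
  have : IsFiniteMeasure m := isFiniteMeasure_withDensity hfin.ne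
  obtain ⟨n, hn⟩ : ∃ n, m (compactCovering G n)ᶜ < ε * μ A := by
    have hlim : Tendsto (fun n => m (compactCovering G n)ᶜ) atTop (𝓝 0) := by
      have := tendsto_measure_iInter_atTop (μ := m)
        (fun n => (isCompact_compactCovering G n).isClosed.measurableSet.compl.nullMeasurableSet)
        (fun i j hij => compl_subset_compl.2 (compactCovering_subset G hij)) ⟨0, measure_ne_top _ _⟩
      rwa [← compl_iUnion, iUnion_compactCovering, compl_univ, measure_empty] at this
    exact (hlim.eventually_lt_const (ENNReal.mul_pos hε hA0)).exists
  set L := compactCovering G n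
  -- Enlarging `L` to `L * Q` ensures that `γA` avoids `L` whenever `γ` lies outside, since `A⁻¹ ⊆
  -- Q`.
  refine ⟨L * Q, (isCompact_compactCovering G n).mul hQ, fun Γ hΓ => ?_⟩
  let B : Γ → Set G := fun γ => {y | y ∈ (γ : G) • A ∧ (γ : G) ∉ L * Q}
  have hBmeas : ∀ γ, MeasurableSet (B γ) := fun γ =>
    ((hAo.smul (γ : G)).inter isOpen_const).measurableSet
  have hBdisj : Pairwise (Function.onFun Disjoint B) := by
    refine fun γ δ hγδ => disjoint_left.2 ?_
    rintro y ⟨⟨a, ha, hay⟩, -⟩ ⟨⟨b, hb, hby⟩, -⟩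
    have key : ∀ (γ a : G), a ∈ A → γ • a = y → γ ∈ (y * u⁻¹) • U := by
      rintro γ a ha rfl
      obtain ⟨v, hv, hva⟩ := (hAsub ha).2
      have hva : u⁻¹ * v = a⁻¹ := hva
      exact ⟨v, hv, by simp [mul_assoc, hva]⟩
    exact hγδ (Subtype.ext (hΓ (y * u⁻¹) ⟨γ.2, key _ a ha hay⟩ ⟨δ.2, key _ b hb hby⟩))
  have hBsub : ⋃ γ, B γ ⊆ Lᶜ := by
    refine iUnion_subset fun γ => ?_
    rintro _ ⟨⟨a, ha, rfl⟩, hγ⟩ hL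
    exact hγ ⟨_, hL, a⁻¹, (hAsub ha).1, by simp⟩
  have hle : ∀ γ : Γ, (L * Q)ᶜ.indicator (fun g => ‖F g‖ₑ ^ 2) γ * μ A ≤ m (B γ) := by
    intro γ
    by_cases hγ : (γ : G) ∈ L * Q
    · simp [hγ]
    · have hB : B γ = (γ : G) • A := by ext y; simp [B, hγ]
      rw [indicator_of_mem (mem_compl hγ), hB, withDensity_apply _ (hAo.smul _).measurableSet,
        ← measure_smul μ (γ : G) A, ← setLIntegral_const]
      refine setLIntegral_mono hMmeas ?_
      rintro _ ⟨a, ha, rfl⟩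
      refine pow_le_pow_left' ?_ 2
      have := le_iSup₂ (f := fun q (_ : q ∈ Q) => ‖F (γ * a * q)‖ₑ) a⁻¹ (hAsub ha).1
      simp only [mul_inv_cancel_right] at this
      exact this
  refine (ENNReal.mul_le_mul_iff_left hA0 hAtop).1 ?_
  calc (∑' γ : Γ, (L * Q)ᶜ.indicator (fun g => ‖F g‖ₑ ^ 2) γ) * μ A
      = ∑' γ : Γ, (L * Q)ᶜ.indicator (fun g => ‖F g‖ₑ ^ 2) γ * μ A := ENNReal.tsum_mul_right.symm
    _ ≤ ∑' γ, m (B γ) := ENNReal.tsum_le_tsum hle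
    _ ≤ m (⋃ γ, B γ) := tsum_meas_le_meas_iUnion_of_disjoint m hBmeas hBdisj
    _ ≤ m Lᶜ := measure_mono hBsub
    _ ≤ ε * μ A := hn.le

end Tails

/-! ### Truncation, averaging over the hull, and sums over translates. -/

theorem eLpNorm_two_sq {G : Type*} [MeasurableSpace G] (μ : Measure G) (F : G → ℂ) :
    eLpNorm F 2 μ ^ 2 = ∫⁻ g, ‖F g‖ₑ ^ 2 ∂μ := by
  have := eLpNorm_nnreal_pow_eq_lintegral (f := F) (μ := μ) (p := 2) two_ne_zero
  simpa using this

/-- Truncation of `|F|²` to a function in `C_c(G)` that agrees with it on a given compact set. -/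
theorem exists_hasCompactSupport_eq_enorm_sq {G : Type*} [TopologicalSpace G] [R1Space G]
    [LocallyCompactSpace G] {F : G → ℂ} (hF : Continuous fun g => ‖F g‖)
    {K : Set G} (hK : IsCompact K) :
    ∃ k : G → ℝ, Continuous k ∧ HasCompactSupport k ∧ (∀ g, 0 ≤ k g) ∧
      (∀ g, ENNReal.ofReal (k g) ≤ ‖F g‖ₑ ^ 2) ∧ ∀ g ∈ K, ENNReal.ofReal (k g) = ‖F g‖ₑ ^ 2 := by
  obtain ⟨p, hp1, -, hpc, hp01⟩ := exists_continuous_one_zero_of_isCompact hK isClosed_empty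
    (disjoint_empty K)
  have heq : ∀ g, ENNReal.ofReal (‖F g‖ ^ 2) = ‖F g‖ₑ ^ 2 := fun g => by
    rw [ENNReal.ofReal_pow (norm_nonneg _), ofReal_norm]
  have hcont : Continuous fun g => p g * ‖F g‖ ^ 2 := p.continuous.mul (hF.pow 2)
  have hcs : HasCompactSupport fun g => p g * ‖F g‖ ^ 2 := hpc.mul_right
  refine ⟨fun g => p g * ‖F g‖ ^ 2, hcont, hcs,
    fun g => mul_nonneg (hp01 g).1 (sq_nonneg _), fun g => ?_, fun g hg => ?_⟩
  · rw [← heq]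
    exact ENNReal.ofReal_le_ofReal (mul_le_of_le_one_left (sq_nonneg _) (hp01 g).2)
  · have hpg : p g = 1 := hp1 hg
    simp only [← heq, hpg, one_mul]

section Sums

variable {G : Type*} [Group G] [TopologicalSpace G] [IsTopologicalGroup G] {Λ : ClosedSubset G}

theorem ofReal_periodization {k : G → ℝ} (hk : ∀ g, 0 ≤ k g) {Γ : hull Λ}
    (hs : Summable fun γ : ((Γ : ClosedSubset G) : Set G) => k γ) :
    ENNReal.ofReal (periodization k Γ) =
      ∑' γ : ((Γ : ClosedSubset G) : Set G), ENNReal.ofReal (k γ) :=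
  ENNReal.ofReal_tsum_of_nonneg (fun γ => hk γ) hs

variable [MeasurableSpace G]

theorem IsCovolume.integral_le {μ : Measure G} {ν : Measure (hull Λ)} [IsProbabilityMeasure ν]
    {c : ℝ} (hc : IsCovolume μ ν c) {k : G → ℝ} (hk : Continuous k) (hkc : HasCompactSupport k)
    {a : ℝ} (h : ∀ Γ : hull Λ, periodization k Γ ≤ a) : ∫ g, k g ∂μ ≤ a * c := by
  obtain ⟨hi, he⟩ := hc.2 k hk hkc
  have := integral_mono hi (integrable_const a) h
  rw [he, integral_const, probReal_univ, one_smul, inv_mul_le_iff₀ hc.1] at this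
  linarith

theorem IsCovolume.le_integral {μ : Measure G} {ν : Measure (hull Λ)} [IsProbabilityMeasure ν]
    {c : ℝ} (hc : IsCovolume μ ν c) {k : G → ℝ} (hk : Continuous k) (hkc : HasCompactSupport k)
    {a : ℝ} (h : ∀ Γ : hull Λ, a ≤ periodization k Γ) : a * c ≤ ∫ g, k g ∂μ := by
  obtain ⟨hi, he⟩ := hc.2 k hk hkc
  have := integral_mono (integrable_const a) hi h
  rw [he, integral_const, probReal_univ, one_smul, le_inv_mul_iff₀ hc.1] at this
  linarith

variable {H : Type*} [NormedAddCommGroup H] [InnerProductSpace ℂ H]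
  (π : ProjectiveUnitaryRep G H)

/-- Reduces orbit points to the given frame inequality on `Λ`, applied to the vector `π(x)⁻¹ f` of
equal norm. -/
theorem tsum_smul_enorm_waveletTransform_sq (ψ f : H) (x : G) :
    ∑' γ : ((x • Λ : ClosedSubset G) : Set G), ‖π.waveletTransform ψ f γ‖ₑ ^ 2 =
      ∑' l : (Λ : Set G), ‖inner ℂ (π l ψ) ((π x).symm f)‖ₑ ^ 2 := by
  let e : (Λ : Set G) ≃ ((x • Λ : ClosedSubset G) : Set G) := (MulAction.toPerm x).image _
  rw [← e.tsum_eq]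
  refine tsum_congr fun l => ?_
  have h : ‖π.waveletTransform ψ f (x * l)‖ₑ = ‖π.waveletTransform ψ ((π x).symm f) l‖ₑ := by
    rw [← ofReal_norm, π.norm_waveletTransform_mul, ofReal_norm]
  exact congrArg (· ^ 2) h

end Sums

/-! ### The two norm inequalities. -/

section Frames

variable {G : Type*} [Group G] [TopologicalSpace G] [IsTopologicalGroup G]
  [LocallyCompactSpace G] [SecondCountableTopology G] [T2Space G]
  [MeasurableSpace G] [BorelSpace G]

/-- To bound the integral of a function it suffices to bound its integrals over compact sets. -/
theorem lintegral_le_of_forall_isCompact {μ : Measure G} {F : G → ℝ≥0∞} {a : ℝ≥0∞}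
    (h : ∀ K, IsCompact K → ∫⁻ g in K, F g ∂μ ≤ a) : ∫⁻ g, F g ∂μ ≤ a := by
  have hK := fun n => (isCompact_compactCovering G n).isClosed.measurableSet
  have := (monotone_nat_of_le_succ fun n => compactCovering_subset G n.le_succ).measure_iUnion
    (μ := μ.withDensity F)
  rw [iUnion_compactCovering, withDensity_apply _ MeasurableSet.univ, setLIntegral_univ] at this
  rw [this]
  exact iSup_le fun n => by
    rw [withDensity_apply _ (hK n)]; exact h _ (isCompact_compactCovering G n)

variable {Λ : ClosedSubset G} {H : Type*} [NormedAddCommGroup H] [InnerProductSpace ℂ H]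
  {π : ProjectiveUnitaryRep G H} {μ : Measure G} [μ.IsHaarMeasure] {ν : Measure (hull Λ)} [IsProbabilityMeasure ν]
  {c : ℝ} {U : Set G} {ψ : H}

/-- A cut-off lies below `|C_ψ f|²`, so its periodization inherits the Bessel bound and no tail
estimate is needed. -/
theorem IsBesselBound.eLpNorm_waveletTransform_sq_le (hc : IsCovolume μ ν c) (hU : IsOpen U)
    (hne : U.Nonempty) (hΛ : IsSeparatedBy U (Λ : Set G)) {C : ℝ} (hC : 0 ≤ C)
    (h : IsBesselBound (fun l : (Λ : Set G) => π l ψ) C) (f : H) :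
    eLpNorm (π.waveletTransform ψ f) 2 μ ^ 2 ≤ ENNReal.ofReal (C * c * ‖f‖ ^ 2) := by
  have hF := π.continuous_norm_waveletTransform ψ f
  rw [eLpNorm_two_sq]
  refine lintegral_le_of_forall_isCompact fun K hK => ?_
  obtain ⟨k, hkc, hks, hk0, hkle, hkK⟩ := exists_hasCompactSupport_eq_enorm_sq hF hK
  have hper : ∀ Γ : hull Λ, periodization k Γ ≤ C * ‖f‖ ^ 2 := by
    refine hull_induction (isClosed_le (continuous_periodization hU hne hΛ hkc hks)
      continuous_const) fun x hx => ?_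
    rw [← ENNReal.ofReal_le_ofReal_iff (by positivity),
      ofReal_periodization hk0 (summable_periodization hU hne hΛ hkc hks _)]
    calc _ ≤ ∑' γ : ((x • Λ : ClosedSubset G) : Set G), ‖π.waveletTransform ψ f γ‖ₑ ^ 2 :=
          ENNReal.tsum_le_tsum fun γ => hkle γ
      _ ≤ _ := by
          rw [tsum_smul_enorm_waveletTransform_sq, ← (π x).symm.norm_map f]
          exact h _
  calc ∫⁻ g in K, ‖π.waveletTransform ψ f g‖ₑ ^ 2 ∂μ = ∫⁻ g in K, ENNReal.ofReal (k g) ∂μ :=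
        (setLIntegral_congr_fun hK.isClosed.measurableSet hkK).symm
    _ ≤ ∫⁻ g, ENNReal.ofReal (k g) ∂μ := setLIntegral_le_lintegral _ _
    _ = ENNReal.ofReal (∫ g, k g ∂μ) := (ofReal_integral_eq_lintegral_ofReal
        (hkc.integrable_of_hasCompactSupport hks) (ae_of_all _ hk0)).symm
    _ ≤ ENNReal.ofReal (C * c * ‖f‖ ^ 2) := ENNReal.ofReal_le_ofReal
        ((hc.integral_le hkc hks hper).trans_eq (by ring))

theorem IsLowerFrameBound.le_eLpNorm_waveletTransform_sq (hc : IsCovolume μ ν c) (hU : IsOpen U)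
    (hne : U.Nonempty) (hΛ : IsSeparatedBy U (Λ : Set G)) {Q : Set G} (hQ : IsCompact Q)
    (hQ1 : Q ∈ 𝓝 (1 : G)) (hψ : ψ ∈ spaceB μ Q π) {C : ℝ}
    (h : IsLowerFrameBound (fun l : (Λ : Set G) => π l ψ) C) (f : H) :
    ENNReal.ofReal (C * c * ‖f‖ ^ 2) ≤ eLpNorm (π.waveletTransform ψ f) 2 μ ^ 2 := by
  have hF := π.continuous_norm_waveletTransform ψ f
  rw [eLpNorm_two_sq]
  refine ENNReal.le_of_forall_pos_le_add fun ε hε _ => ?_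
  -- The tail allowance is multiplied by `c` on passing to the integral, leaving a loss of `ε`.
  have hδ : 0 < (ε : ℝ) / c := div_pos hε hc.1
  obtain ⟨K, hK, htail⟩ := exists_isCompact_tsum_indicator_le μ hQ hQ1 hU hne hF (hψ f).2
    (ENNReal.ofReal_pos.2 hδ).ne'
  obtain ⟨k, hkc, hks, hk0, hkle, hkK⟩ := exists_hasCompactSupport_eq_enorm_sq hF hK
  have hper : ∀ Γ : hull Λ, C * ‖f‖ ^ 2 - ε / c ≤ periodization k Γ := by
    refine hull_induction (isClosed_le continuous_const
      (continuous_periodization hU hne hΛ hkc hks)) fun x hx => ?_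
    have hp0 : 0 ≤ periodization k (⟨x • Λ, hx⟩ : hull Λ) := periodization_nonneg hk0 _
    rw [sub_le_iff_le_add, ← ENNReal.ofReal_le_ofReal_iff (by positivity),
      ENNReal.ofReal_add hp0 hδ.le,
      ofReal_periodization hk0 (summable_periodization hU hne hΛ hkc hks _)]
    calc ENNReal.ofReal (C * ‖f‖ ^ 2)
        ≤ ∑' γ : ((x • Λ : ClosedSubset G) : Set G), ‖π.waveletTransform ψ f γ‖ₑ ^ 2 := by
          rw [tsum_smul_enorm_waveletTransform_sq, ← (π x).symm.norm_map f]
          exact h _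
      _ ≤ ∑' γ : ((x • Λ : ClosedSubset G) : Set G), (ENNReal.ofReal (k γ) +
            Kᶜ.indicator (fun g => ‖π.waveletTransform ψ f g‖ₑ ^ 2) γ) := by
          refine ENNReal.tsum_le_tsum fun γ => ?_
          -- On `K` the cut-off is exact; off `K` the indicator term alone accounts for the summand.
          by_cases hγ : (γ : G) ∈ K
          · rw [hkK _ hγ]; exact le_self_add
          · rw [indicator_of_mem (mem_compl hγ)]; exact le_add_self
      _ ≤ _ := by
          rw [ENNReal.tsum_add]
          gcongr
          exact htail _ (isSeparatedBy_smul hΛ x)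
  have hint := hc.le_integral hkc hks hper
  have hcε : (C * ‖f‖ ^ 2 - ε / c) * c = C * c * ‖f‖ ^ 2 - ε := by
    field_simp [hc.1.ne']
  calc ENNReal.ofReal (C * c * ‖f‖ ^ 2) ≤ ENNReal.ofReal (∫ g, k g ∂μ + ε) :=
        ENNReal.ofReal_le_ofReal (by linarith)
    _ ≤ ENNReal.ofReal (∫ g, k g ∂μ) + ENNReal.ofReal ε := ENNReal.ofReal_add_le
    _ = ∫⁻ g, ENNReal.ofReal (k g) ∂μ + ε := by
        rw [ofReal_integral_eq_lintegral_ofReal (hkc.integrable_of_hasCompactSupport hks)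
          (ae_of_all _ hk0), ENNReal.ofReal_coe_nnreal]
    _ ≤ _ := by gcongr with g; exact hkle g

end Frames

end FrameCovol

theorem mainTheorem3 {G : Type*} [Group G] [TopologicalSpace G] [IsTopologicalGroup G]
    [LocallyCompactSpace G] [SecondCountableTopology G] [T2Space G]
    [MeasurableSpace G] [BorelSpace G] (μ : Measure G) [μ.IsHaarMeasure]
    {H : Type*} [NormedAddCommGroup H] [InnerProductSpace ℂ H] [CompleteSpace H]
    (π : ProjectiveUnitaryRep G H)
    (Q : Set G) (hQ : IsCompact Q) (hQ_nhds : Q ∈ 𝓝 (1 : G))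
    (Λ : Set G) (hΛ : IsDelone Λ)
    (ν : Measure (ClosedSubset.hull hΛ.toClosed)) [IsProbabilityMeasure ν]
    [SMulInvariantMeasure G (ClosedSubset.hull hΛ.toClosed) ν] (ψ : H) :
    IsCovolume μ ν (covol μ ν) ∧
    (∀ C₂ : ℝ, 0 < C₂ → IsBesselBound (fun l : Λ => π l ψ) C₂ →
      ∀ f : H, eLpNorm (π.waveletTransform ψ f) 2 μ ^ 2 ≤
        ENNReal.ofReal (C₂ * covol μ ν * ‖f‖ ^ 2)) ∧
    (∀ C₁ : ℝ, 0 < C₁ → ψ ∈ spaceB μ Q π → IsLowerFrameBound (fun l : Λ => π l ψ) C₁ →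
      ∀ f : H, ENNReal.ofReal (C₁ * covol μ ν * ‖f‖ ^ 2) ≤
        eLpNorm (π.waveletTransform ψ f) 2 μ ^ 2) := by
  obtain ⟨⟨U, hU, hne, hsep⟩, -⟩ := id hΛ
  have hc : IsCovolume μ ν (covol μ ν) := isCovolume_covol μ (Λ := hΛ.toClosed) hΛ ν
  exact ⟨hc, fun C₂ hC₂ h f =>
      IsBesselBound.eLpNorm_waveletTransform_sq_le (Λ := hΛ.toClosed) hc hU hne hsep hC₂.le h f,
    fun C₁ _ hψ h f => IsLowerFrameBound.le_eLpNorm_waveletTransform_sq (Λ := hΛ.toClosed) hc hU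
      hne hsep hQ hQ_nhds hψ h f⟩
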